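/- Let $N$ be a finite set. For $f: 2^N \to \mathbb{R} \cup \{-\infty\}$ write $\operatorname{dom} f = \{X \subseteq N \mid f(X) > -\infty\}$, and use the conventions $(-\infty)+a = a+(-\infty) = (-\infty)+(-\infty) = -\infty$ for $a \in \mathbb{R}$, and $-\infty \le -\infty$. Call $f$ M$^\natural$-concave if $\operatorname{dom} f \neq \emptyset$ and, for all $X, Y \in \operatorname{dom} f$ and $i \in X \setminus Y$, either (i) $X \setminus \{i\} \in \operatorname{dom} f$, $Y \cup \{i\} \in \operatorname{dom} f$ and $f(X)+f(Y) \le f(X \setminus \{i\}) + f(Y \cup \{i\})$, or (ii) there exists $j \in Y \setminus X$ such that $(X \setminus \{i\}) \cup \{j\} \in \operatorname{dom} f$, $(Y \cup \{i\}) \setminus \{j\} \in \operatorname{dom} f$ and $f(X)+f(Y) \le f((X \setminus \{i\}) \cup \{j\}) + f((Y \cup \{i\}) \setminus \{j\})$. Theorem. Every M$^\natural$-concave function $f: 2^N \to \mathbb{R} \cup \{-\infty\}$ has the multiple exchange property: for any $X, Y \subseteq N$ and $I \subseteq X \setminus Y$ there exists $J \subseteq Y \setminus X$ such that $$f(X)+f(Y)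 \le f((X \setminus I) \cup J) + f((Y \setminus J) \cup I).$$ -/

import Mathlib

/-- The effective domain `{X | f X > -∞}` of a set function `f : 2^N → ℝ ∪ {-∞}`.
The value `-∞` is `⊥ : WithBot ℝ`, for which `⊥ + a = a + ⊥ = ⊥`. -/
def effDom {N : Type*} (f : Finset N → WithBot ℝ) : Set (Finset N) :=
  {X | ⊥ < f X}

/-- `f` is M♮-concave: its effective domain is non-empty, and for all `X, Y ∈ dom f` and
`i ∈ X \ Y`, either (i) `X - i, Y + i ∈ dom f` and `f X + f Y ≤ f (X - i) + f (Y + i)`, or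
(ii) for some `j ∈ Y \ X`, `X - i + j, Y + i - j ∈ dom f` and
`f X + f Y ≤ f (X - i + j) + f (Y + i - j)`. -/
def IsMNatConcave {N : Type*} [DecidableEq N] (f : Finset N → WithBot ℝ) : Prop :=
  (effDom f).Nonempty ∧
    ∀ X ∈ effDom f, ∀ Y ∈ effDom f, ∀ i ∈ X \ Y,
      (X \ {i} ∈ effDom f ∧ Y ∪ {i} ∈ effDom f ∧
          f X + f Y ≤ f (X \ {i}) + f (Y ∪ {i})) ∨
        ∃ j ∈ Y \ X,
          (X \ {i}) ∪ {j} ∈ effDom f ∧ (Y ∪ {i}) \ {j} ∈ effDom f ∧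
            f X + f Y ≤ f ((X \ {i}) ∪ {j}) + f ((Y ∪ {i}) \ {j})

/-- The multiple exchange property of a set function. -/
def HasMultipleExchange {N : Type*} [DecidableEq N] (f : Finset N → WithBot ℝ) : Prop :=
  ∀ X Y I : Finset N, I ⊆ X \ Y →
    ∃ J : Finset N, J ⊆ Y \ X ∧ f X + f Y ≤ f ((X \ I) ∪ J) + f ((Y \ J) ∪ I)

/-! Fix X, Y and I. Choosing J means splitting Y \ X into J and K so that f((X \ I) ∪ J) + f((X ∩ Y)
∪ I ∪ K) is at least f(X) + f(Y). By Fenchel duality (`exists_partition_of_forall_price`) it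
suffices that, at every price q on Y \ X, unconstrained J and K reach f(X) + f(Y) − q(Y \ X). This
follows from `ExchangeOn.exists_distribute`: exchanges can split X \ Y as prescribed if the outcome
on Y \ X is left free.

The duality rests on submodularity of the conjugate p ↦ max (f(A) − p(A)). The two functions are put
on disjoint copies of the ground set, and the constraint that exactly one copy of z is used is
imposed for one z at a time, by a Lagrange multiplier and without loss of value. -/

/-- The value of `A` for `f` at the price vector `p`. -/
def netValue {E : Type*} (f : Finset E → ℝ) (p : E → ℝ) (A : Finset E) : ℝ :=
  f A - ∑ x ∈ A, p x

/-- The M♮-exchange property of a real function on a family of finite sets. -/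
def ExchangeOn {E : Type*} [DecidableEq E] (S : Set (Finset E)) (f : Finset E → ℝ) : Prop :=
  ∀ X ∈ S, ∀ Y ∈ S, ∀ i ∈ X \ Y, ∃ X' ∈ S, ∃ Y' ∈ S, f X + f Y ≤ f X' + f Y' ∧
    ((X' = X \ {i} ∧ Y' = Y ∪ {i}) ∨
      ∃ j ∈ Y \ X, X' = (X \ {i}) ∪ {j} ∧ Y' = (Y ∪ {i}) \ {j})

/-- Submodularity of `p ↦ max_{A ∈ S} netValue f p A` on the prices vanishing on `V`. -/
def ConjSubmodular {E : Type*} (S : Set (Finset E)) (f : Finset E → ℝ) (V : Set E) : Prop :=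
  ∀ p p' : E → ℝ, (∀ x ∈ V, p x = 0) → (∀ x ∈ V, p' x = 0) → ∀ A ∈ S, ∀ B ∈ S,
    ∃ A' ∈ S, ∃ B' ∈ S,
      netValue f (p ⊓ p') A + netValue f (p ⊔ p') B ≤ netValue f p A' + netValue f p' B'

/-- The members of `S` that contain exactly one of `a` and `b`. -/
def cutBy {E : Type*} (S : Set (Finset E)) (a b : E) : Set (Finset E) :=
  {A ∈ S | (a ∈ A ∧ b ∉ A) ∨ (a ∉ A ∧ b ∈ A)}

/-- The price vector `p` raised by `s` at `a` and by `t` at `b`. -/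
def raise {E : Type*} [DecidableEq E] (p : E → ℝ) (a b : E) (s t : ℝ) : E → ℝ :=
  fun x => p x + (if x = a then s else 0) + (if x = b then t else 0)

theorem sum_le_sum_of_mem_of_ne_zero {E : Type*} {u : E → ℝ} (hu : ∀ x, 0 ≤ u x) {A B : Finset E}
    (h : ∀ x ∈ A, u x ≠ 0 → x ∈ B) : ∑ x ∈ A, u x ≤ ∑ x ∈ B, u x := by
  rw [← Finset.sum_filter_ne_zero]
  refine Finset.sum_le_sum_of_subset_of_nonneg (fun x hx => ?_) fun x _ _ => hu x
  rw [Finset.mem_filter] at hx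
  exact h x hx.1 hx.2

/-! ### Exchange and submodularity of the conjugate -/

section Exchange

variable {E : Type*} [DecidableEq E]

theorem sum_add_sum_eq_of_exchange (p : E → ℝ) {X Y X' Y' : Finset E} {i : E} (hi : i ∈ X \ Y)
    (h : (X' = X \ {i} ∧ Y' = Y ∪ {i}) ∨
      ∃ j ∈ Y \ X, X' = (X \ {i}) ∪ {j} ∧ Y' = (Y ∪ {i}) \ {j}) :
    ∑ x ∈ X', p x + ∑ x ∈ Y', p x = ∑ x ∈ X, p x + ∑ x ∈ Y, p x := by
  rw [← Finset.sum_union_inter, ← Finset.sum_union_inter (s₁ := X)]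
  have hU : X' ∪ Y' = X ∪ Y := by
    ext x
    grind
  have hI : X' ∩ Y' = X ∩ Y := by
    ext x
    grind
  rw [hU, hI]

theorem ExchangeOn.netValue {S : Set (Finset E)} {f : Finset E → ℝ} (h : ExchangeOn S f)
    (p : E → ℝ) : ExchangeOn S (netValue f p) := by
  intro X hX Y hY i hi
  obtain ⟨X', hX', Y', hY', hle, hex⟩ := h X hX Y hY i hi
  refine ⟨X', hX', Y', hY', ?_, hex⟩
  have := sum_add_sum_eq_of_exchange p hi hex
  simp only [_root_.netValue]
  linarith

/-- An exchange only moves elements of the symmetric difference, so both new sets stay between X ∩ Y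
and X ∪ Y. -/
theorem ExchangeOn.interval {S : Set (Finset E)} {f : Finset E → ℝ} (h : ExchangeOn S f)
    (L U : Finset E) : ExchangeOn {A ∈ S | L ⊆ A ∧ A ⊆ U} f := by
  rintro X ⟨hX, hLX, hXU⟩ Y ⟨hY, hLY, hYU⟩ i hi
  obtain ⟨X', hX', Y', hY', hle, hex⟩ := h X hX Y hY i hi
  refine ⟨X', ⟨hX', ?_, ?_⟩, Y', ⟨hY', ?_, ?_⟩, hle, hex⟩ <;> intro x hx <;> grind

/-- Elements of `X` that are missing from `Y` can be distributed in any prescribed way. -/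
theorem ExchangeOn.exists_distribute [Finite E] {S : Set (Finset E)} {f : Finset E → ℝ}
    (h : ExchangeOn S f) (D : Finset E) {Y : Finset E} (hY : Y ∈ S) (hYD : Y ∩ D = ∅)
    (I : Finset E) : ∀ X ∈ S, I ⊆ X ∩ D → ∃ X' ∈ S, ∃ Y' ∈ S,
      X' ∩ D = (X ∩ D) \ I ∧ Y' ∩ D = I ∧ f X + f Y ≤ f X' + f Y' := by
  induction I using Finset.induction_on with
  | empty =>
    intro X hX _
    exact ⟨X, hX, Y, hY, by simp, hYD, le_rfl⟩
  | insert i I hiI ih =>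
    intro X hX hIX
    have hiX := Finset.mem_inter.1 (hIX (Finset.mem_insert_self _ _))
    have hYD' : ∀ x ∈ D, x ∉ Y := fun x hxD hxY =>
      Finset.notMem_empty x (hYD ▸ Finset.mem_inter.2 ⟨hxY, hxD⟩)
    have hiY : i ∈ X \ Y := Finset.mem_sdiff.2 ⟨hiX.1, hYD' i hiX.2⟩
    obtain ⟨Z, hZ, _, -, -, hZex⟩ := h X hX Y hY i hiY
    have hZD : Z ∩ D = (X ∩ D) \ {i} := by
      clear ih h
      rcases hZex with ⟨rfl, -⟩ | ⟨j, hj, rfl, -⟩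
      · ext x
        grind
      · have hjD : j ∉ D := fun hjD => hYD' j hjD (Finset.mem_sdiff.1 hj).1
        ext x
        grind
    -- `W` is taken optimal so that the later exchange of `i` between `X` and `Y'`, whose `X₂` has
    -- the same trace on `D`, satisfies f X₂ ≤ f W; adding the two inequalities then cancels `W` and
    -- `Y'`.
    obtain ⟨W, ⟨hW, hWD⟩, hWmax⟩ := Set.exists_max_image {W ∈ S | W ∩ D = (X ∩ D) \ {i}} f
      (Set.toFinite _) ⟨Z, hZ, hZD⟩
    obtain ⟨X', hX', Y', hY', hX'D, hY'D, hle⟩ := ih W hW (by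
      intro x hx
      rw [hWD, Finset.mem_sdiff, Finset.mem_singleton]
      exact ⟨hIX (Finset.mem_insert_of_mem hx), fun h => hiI (h ▸ hx)⟩)
    have hY'I : ∀ x ∈ D, (x ∈ Y' ↔ x ∈ I) := fun x hx => by simp [← hY'D, hx]
    have hIX' : ∀ x ∈ I, x ∈ X := fun x hx =>
      (Finset.mem_inter.1 (hIX (Finset.mem_insert_of_mem hx))).1
    have hiY' : i ∈ X \ Y' := Finset.mem_sdiff.2 ⟨hiX.1, fun h => hiI ((hY'I i hiX.2).1 h)⟩
    obtain ⟨X₂, hX₂, Y₂, hY₂, hle₂, hex⟩ := h X hX Y' hY' i hiY'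
    have hX₂D : X₂ ∩ D = (X ∩ D) \ {i} := by
      clear ih h
      ext x
      grind
    have hY₂D : Y₂ ∩ D = insert i I := by
      clear ih h
      rw [← hY'D]
      ext x
      grind
    refine ⟨X', hX', Y₂, hY₂, ?_, hY₂D, ?_⟩
    · rw [hX'D, hWD]
      ext x
      grind
    · have := hWmax X₂ ⟨hX₂, hX₂D⟩
      linarith

/-- Each element of A \ B goes to the set that faces the lower of its two prices, so there it pays
just p ⊓ p'. The excess over p ⊓ p' is then paid only on elements of B. -/
theorem ExchangeOn.conjSubmodular [Finite E] {S : Set (Finset E)} {f : Finset E → ℝ}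
    (h : ExchangeOn S f) (V : Set E) : ConjSubmodular S f V := by
  intro p p' _ _ A hA B hB
  obtain ⟨X', ⟨hX', -, hX'U⟩, Y', ⟨hY', -, hY'U⟩, hX'D, hY'D, hle⟩ :=
    ((h.netValue (p ⊓ p')).interval (A ∩ B) (A ∪ B)).exists_distribute (A \ B) (Y := B)
      ⟨hB, Finset.inter_subset_right, Finset.subset_union_right⟩ (by ext x; grind)
      {x ∈ A \ B | p' x < p x} A
      ⟨hA, Finset.inter_subset_left, Finset.subset_union_left⟩ (by intro x; grind)
  refine ⟨X', hX', Y', hY', ?_⟩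
  have h1 : ∑ x ∈ X', (p x - (p ⊓ p') x) ≤ ∑ x ∈ B, (p x - (p ⊓ p') x) := by
    refine sum_le_sum_of_mem_of_ne_zero (fun x => by simp) fun x hx hne => ?_
    by_contra hxB
    have hxD : x ∈ A \ B := by
      have := hX'U hx
      grind
    have hx' : x ∈ X' ∩ (A \ B) := Finset.mem_inter.2 ⟨hx, hxD⟩
    rw [hX'D] at hx'
    have : p x ≤ p' x := by grind
    exact hne (by simp [this])
  have h2 : ∑ x ∈ Y', (p' x - (p ⊓ p') x) ≤ ∑ x ∈ B, (p' x - (p ⊓ p') x) := by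
    refine sum_le_sum_of_mem_of_ne_zero (fun x => by simp) fun x hx hne => ?_
    by_contra hxB
    have hxD : x ∈ A \ B := by
      have := hY'U hx
      grind
    have hx' : x ∈ Y' ∩ (A \ B) := Finset.mem_inter.2 ⟨hx, hxD⟩
    rw [hY'D, Finset.mem_filter] at hx'
    exact hne (by simp [hx'.2.le])
  have h3 : ∑ x ∈ B, (p ⊓ p') x + ∑ x ∈ B, (p ⊔ p') x = ∑ x ∈ B, p x + ∑ x ∈ B, p' x := by
    rw [← Finset.sum_add_distrib, ← Finset.sum_add_distrib]
    exact Finset.sum_congr rfl fun x _ => by simp [min_add_max]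
  simp only [Finset.sum_sub_distrib] at h1 h2
  simp only [_root_.netValue] at hle ⊢
  linarith

end Exchange

/-! ### Imposing that exactly one of two elements is used -/

section Pairs

variable {E : Type*} [DecidableEq E]

theorem netValue_raise (f : Finset E → ℝ) (p : E → ℝ) (a b : E) (s t : ℝ) (A : Finset E) :
    netValue f (raise p a b s t) A =
      netValue f p A - (if a ∈ A then s else 0) - (if b ∈ A then t else 0) := by
  simp only [netValue, raise, Finset.sum_add_distrib, Finset.sum_ite_eq']
  ring

theorem netValue_raise_of_cutBy {S : Set (Finset E)} {a b : E} {A : Finset E}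
    (hA : A ∈ cutBy S a b) (f : Finset E → ℝ) (p : E → ℝ) (q : ℝ) :
    netValue f (raise p a b q q) A = netValue f p A - q := by
  rw [netValue_raise]
  rcases hA.2 with ⟨h1, h2⟩ | ⟨h1, h2⟩ <;> simp [h1, h2]

theorem raise_inf_raise {p p' : E → ℝ} {a b : E} (hab : a ≠ b) (h : p a = p' a) (h' : p b = p' b)
    (s t s' t' : ℝ) :
    raise p a b s t ⊓ raise p' a b s' t' = raise (p ⊓ p') a b (s ⊓ s') (t ⊓ t') := by
  funext x
  by_cases hxa : x = a
  · subst hxa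
    simp [raise, hab, h, min_add_add_left]
  · by_cases hxb : x = b
    · subst hxb
      simp [raise, hxa, h', min_add_add_left]
    · simp [raise, hxa, hxb]

theorem raise_sup_raise {p p' : E → ℝ} {a b : E} (hab : a ≠ b) (h : p a = p' a) (h' : p b = p' b)
    (s t s' t' : ℝ) :
    raise p a b s t ⊔ raise p' a b s' t' = raise (p ⊔ p') a b (s ⊔ s') (t ⊔ t') := by
  funext x
  by_cases hxa : x = a
  · subst hxa
    simp [raise, hab, h, max_add_add_left]
  · by_cases hxb : x = b
    · subst hxb
      simp [raise, hxa, h', max_add_add_left]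
    · simp [raise, hxa, hxb]

theorem raise_eq_zero {V : Set E} {p : E → ℝ} {a b : E} (ha : a ∉ V) (hb : b ∉ V)
    (hp : ∀ x ∈ V, p x = 0) (s t : ℝ) : ∀ x ∈ V, raise p a b s t x = 0 := by
  intro x hx
  have hxa : x ≠ a := fun h => ha (h ▸ hx)
  have hxb : x ≠ b := fun h => hb (h ▸ hx)
  simp [raise, hxa, hxb, hp x hx]

/-- Midpoint concavity in the number of elements of `{a, b}` that are used. -/
theorem ConjSubmodular.add_le_two_mul [Finite E] {S : Set (Finset E)} {f : Finset E → ℝ} {V : Set E}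
    (h : ConjSubmodular S f V) {a b : E} (hab : a ≠ b) (ha : a ∉ V) (hb : b ∉ V) {p : E → ℝ}
    (hp : ∀ x ∈ V, p x = 0) {m : ℝ} (hm : ∀ C ∈ cutBy S a b, netValue f p C ≤ m)
    {A B : Finset E} (hA : A ∈ S) (haA : a ∈ A) (hbA : b ∈ A)
    (hB : B ∈ S) (haB : a ∉ B) (hbB : b ∉ B) : netValue f p A + netValue f p B ≤ 2 * m := by
  obtain ⟨A₀, ⟨hA₀, haA₀, hbA₀⟩, hAmax⟩ := Set.exists_max_image {A ∈ S | a ∈ A ∧ b ∈ A}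
    (netValue f p) (Set.toFinite _) ⟨A, hA, haA, hbA⟩
  obtain ⟨B₀, ⟨hB₀, haB₀, hbB₀⟩, hBmax⟩ := Set.exists_max_image {A ∈ S | a ∉ A ∧ b ∉ A}
    (netValue f p) (Set.toFinite _) ⟨B, hB, haB, hbB⟩
  have hA₁ := hAmax A ⟨hA, haA, hbA⟩
  have hB₁ := hBmax B ⟨hB, haB, hbB⟩
  by_contra! hlt
  set α := netValue f p A₀ with hα
  set β := netValue f p B₀ with hβ
  -- At price `r` on both `a` and `b`, `A₀` and `B₀` are equally good; `ε` is the excess over `m`.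
  -- At prices r ± ε, in either order, no member of `S` is worth more than `β`, yet the meet and
  -- join give 2β + 2ε.
  obtain ⟨r, hr⟩ : ∃ r, r = (α - β) / 2 := ⟨_, rfl⟩
  obtain ⟨ε, hε⟩ : ∃ ε, ε = (α + β) / 2 - m := ⟨_, rfl⟩
  have hε0 : 0 < ε := by linarith
  obtain ⟨A', hA', B', hB', hle⟩ := h (raise p a b (r + ε) (r - ε)) (raise p a b (r - ε) (r + ε))
    (raise_eq_zero ha hb hp _ _) (raise_eq_zero ha hb hp _ _) A₀ hA₀ B₀ hB₀
  rw [raise_inf_raise hab rfl rfl, raise_sup_raise hab rfl rfl, inf_idem, sup_idem,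
    inf_of_le_right (by linarith), inf_of_le_left (by linarith), netValue_raise,
    netValue_raise] at hle
  simp only [haA₀, hbA₀, haB₀, hbB₀, if_true, if_false] at hle
  have key : ∀ C ∈ S, ∀ s t : ℝ, s + t = 2 * r → r - ε ≤ s → r - ε ≤ t →
      netValue f (raise p a b s t) C ≤ β := by
    intro C hC s t hst hs ht
    rw [netValue_raise]
    by_cases haC : a ∈ C <;> by_cases hbC : b ∈ C <;> simp only [haC, hbC, if_true, if_false]
    · have := hAmax C ⟨hC, haC, hbC⟩
      linarith
    · have := hm C ⟨hC, Or.inl ⟨haC, hbC⟩⟩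
      linarith
    · have := hm C ⟨hC, Or.inr ⟨haC, hbC⟩⟩
      linarith
    · have := hBmax C ⟨hC, haC, hbC⟩
      linarith
  have h1 := key A' hA' (r + ε) (r - ε) (by ring) (by linarith) le_rfl
  have h2 := key B' hB' (r - ε) (r + ε) (by ring) le_rfl (by linarith)
  linarith

theorem exists_between_of_finite {s t : Set ℝ} (hs : s.Finite) (ht : t.Finite)
    (h : ∀ x ∈ s, ∀ y ∈ t, x ≤ y) : ∃ q, (∀ x ∈ s, x ≤ q) ∧ ∀ y ∈ t, q ≤ y := by
  rcases s.eq_empty_or_nonempty with rfl | hne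
  · obtain ⟨q, hq⟩ := ht.bddBelow
    exact ⟨q, by simp, fun y hy => hq hy⟩
  · obtain ⟨q, hq, hmax⟩ := Set.exists_max_image s id hs hne
    exact ⟨q, hmax, fun y hy => h q hq y hy⟩

/-- A Lagrange multiplier for the constraint that exactly one of `a` and `b` is used. -/
theorem ConjSubmodular.exists_multiplier [Finite E] {S : Set (Finset E)} {f : Finset E → ℝ}
    {V : Set E} (h : ConjSubmodular S f V) {a b : E} (hab : a ≠ b) (ha : a ∉ V) (hb : b ∉ V)
    {p : E → ℝ} (hp : ∀ x ∈ V, p x = 0) {m : ℝ} (hm : ∀ C ∈ cutBy S a b, netValue f p C ≤ m) :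
    ∃ q, ∀ C ∈ S, netValue f (raise p a b q q) C ≤ m - q := by
  obtain ⟨q, hq1, hq2⟩ := exists_between_of_finite
    (s := (fun A => netValue f p A - m) '' {A ∈ S | a ∈ A ∧ b ∈ A})
    (t := (fun B => m - netValue f p B) '' {B ∈ S | a ∉ B ∧ b ∉ B})
    (Set.toFinite _) (Set.toFinite _) (by
      rintro _ ⟨A, ⟨hA, haA, hbA⟩, rfl⟩ _ ⟨B, ⟨hB, haB, hbB⟩, rfl⟩
      have := h.add_le_two_mul hab ha hb hp hm hA haA hbA hB haB hbB
      dsimp only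
      linarith)
  refine ⟨q, fun C hC => ?_⟩
  rw [netValue_raise]
  by_cases haC : a ∈ C <;> by_cases hbC : b ∈ C <;> simp only [haC, hbC, if_true, if_false]
  · have := hq1 _ ⟨C, ⟨hC, haC, hbC⟩, rfl⟩
    dsimp only at this
    linarith
  · have := hm C ⟨hC, Or.inl ⟨haC, hbC⟩⟩
    linarith
  · have := hm C ⟨hC, Or.inr ⟨haC, hbC⟩⟩
    linarith
  · have := hq2 _ ⟨C, ⟨hC, haC, hbC⟩, rfl⟩
    dsimp only at this
    linarith

/-- The restricted conjugate is the minimum over q of the old one at `raise p a b q q`, plus q, and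
partial minimization keeps submodularity. Freezing the prices of a and b lets raising commute with
meet and join. -/
theorem ConjSubmodular.restrict_cutBy [Finite E] {S : Set (Finset E)} {f : Finset E → ℝ} {V W : Set E}
    (h : ConjSubmodular S f V) {a b : E} (hab : a ≠ b) (ha : a ∉ V) (hb : b ∉ V)
    (hVW : V ⊆ W) (haW : a ∈ W) (hbW : b ∈ W) : ConjSubmodular (cutBy S a b) f W := by
  intro p p' hp hp' A hA B hB
  obtain ⟨A', hA', hAmax⟩ := Set.exists_max_image (cutBy S a b) (netValue f p)
    (Set.toFinite _) ⟨A, hA⟩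
  obtain ⟨B', hB', hBmax⟩ := Set.exists_max_image (cutBy S a b) (netValue f p')
    (Set.toFinite _) ⟨A, hA⟩
  have hpV : ∀ x ∈ V, p x = 0 := fun x hx => hp x (hVW hx)
  have hpV' : ∀ x ∈ V, p' x = 0 := fun x hx => hp' x (hVW hx)
  obtain ⟨q, hq⟩ := h.exists_multiplier hab ha hb hpV hAmax
  obtain ⟨q', hq'⟩ := h.exists_multiplier hab ha hb hpV' hBmax
  obtain ⟨A'', hA'', B'', hB'', hle⟩ := h (raise p a b q q) (raise p' a b q' q')
    (raise_eq_zero ha hb hpV _ _) (raise_eq_zero ha hb hpV' _ _) A hA.1 B hB.1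
  have h1 := hq A'' hA''
  have h2 := hq' B'' hB''
  have ha0 : p a = p' a := by rw [hp a haW, hp' a haW]
  have hb0 : p b = p' b := by rw [hp b hbW, hp' b hbW]
  rw [raise_inf_raise hab ha0 hb0, raise_sup_raise hab ha0 hb0, netValue_raise_of_cutBy hA,
    netValue_raise_of_cutBy hB] at hle
  have h3 : q ⊓ q' + q ⊔ q' = q + q' := min_add_max q q'
  exact ⟨A', hA', B', hB', by linarith⟩

/-- If every multiplier for the pair `{a, b}` leaves the value `c` attainable, then it is attained
by a set that contains exactly one of `a` and `b`. -/
theorem ConjSubmodular.exists_mem_cutBy [Finite E] {S : Set (Finset E)} {f : Finset E → ℝ}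
    {V : Set E} (h : ConjSubmodular S f V) {a b : E} (hab : a ≠ b) (ha : a ∉ V) (hb : b ∉ V)
    {p : E → ℝ} (hp : ∀ x ∈ V, p x = 0) {c : ℝ}
    (hc : ∀ q, ∃ C ∈ S, c - q ≤ netValue f (raise p a b q q) C) :
    ∃ C ∈ cutBy S a b, c ≤ netValue f p C := by
  by_contra! hlt
  obtain ⟨m, hmc, hm⟩ : ∃ m < c, ∀ C ∈ cutBy S a b, netValue f p C ≤ m := by
    rcases (cutBy S a b).eq_empty_or_nonempty with he | hne
    · exact ⟨c - 1, by linarith, by simp [he]⟩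
    · obtain ⟨C, hC, hmax⟩ := Set.exists_max_image (cutBy S a b) (netValue f p)
        (Set.toFinite _) hne
      exact ⟨_, hlt C hC, hmax⟩
  obtain ⟨q, hq⟩ := h.exists_multiplier hab ha hb hp hm
  obtain ⟨C, hC, hle⟩ := hc q
  have := hq C hC
  linarith

end Pairs

/-! ### Discrete Fenchel duality -/

section Intersection

variable {α : Type*}

theorem sum_eq_toLeft_add_toRight (p : α ⊕ α → ℝ) (A : Finset (α ⊕ α)) :
    ∑ x ∈ A, p x = ∑ x ∈ A.toLeft, p (Sum.inl x) + ∑ x ∈ A.toRight, p (Sum.inr x) := by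
  conv_lhs => rw [← Finset.toLeft_disjSum_toRight (u := A)]
  rw [Finset.sum_disjSum]

theorem ConjSubmodular.disjSum {S T : Set (Finset α)} {f g : Finset α → ℝ}
    (hS : ConjSubmodular S f ∅) (hT : ConjSubmodular T g ∅) :
    ConjSubmodular {A : Finset (α ⊕ α) | A.toLeft ∈ S ∧ A.toRight ∈ T}
      (fun A => f A.toLeft + g A.toRight) ∅ := by
  rintro p p' - - A ⟨hA1, hA2⟩ B ⟨hB1, hB2⟩
  obtain ⟨A₁, hA₁, B₁, hB₁, h1⟩ := hS (p ∘ Sum.inl) (p' ∘ Sum.inl) (by simp) (by simp) _ hA1 _ hB1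
  obtain ⟨A₂, hA₂, B₂, hB₂, h2⟩ := hT (p ∘ Sum.inr) (p' ∘ Sum.inr) (by simp) (by simp) _ hA2 _ hB2
  refine ⟨A₁.disjSum A₂, by simp [hA₁, hA₂], B₁.disjSum B₂, by simp [hB₁, hB₂], ?_⟩
  simp only [netValue, sum_eq_toLeft_add_toRight, Finset.toLeft_disjSum, Finset.toRight_disjSum,
    Function.comp_apply, Pi.inf_apply, Pi.sup_apply] at h1 h2 ⊢
  linarith

/-- Discrete Fenchel duality for the constraint that the two sets partition `Y`. -/
theorem exists_partition_of_forall_price [DecidableEq α] [Finite α] {S T : Set (Finset α)} {f g : Finset α → ℝ}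
    (hS : ConjSubmodular S f ∅) (hT : ConjSubmodular T g ∅) (Y : Finset α)
    (hTY : ∀ K ∈ T, K ⊆ Y) {c : ℝ}
    (hc : ∀ q : α → ℝ, ∃ J ∈ S, ∃ K ∈ T, c - ∑ y ∈ Y, q y ≤ netValue f q J + netValue g q K) :
    ∃ J ∈ S, Y \ J ∈ T ∧ c ≤ f J + g (Y \ J) := by
  -- `Z` holds the elements whose constraint is already imposed; their prices are frozen at 0, so at
  -- Z = Y only q = 0 remains.
  have key : ∀ Z ⊆ Y, ∃ R : Set (Finset (α ⊕ α)),
      (∀ A ∈ R, A.toLeft ∈ S ∧ A.toRight ∈ T ∧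
        ∀ z ∈ Z, (z ∈ A.toLeft ∧ z ∉ A.toRight) ∨ (z ∉ A.toLeft ∧ z ∈ A.toRight)) ∧
      ConjSubmodular R (fun A => f A.toLeft + g A.toRight) {x | Sum.elim id id x ∈ Z} ∧
      ∀ q : α → ℝ, (∀ z ∈ Z, q z = 0) → ∃ A ∈ R, c - ∑ y ∈ Y, q y ≤
        netValue (fun A => f A.toLeft + g A.toRight) (Sum.elim q q) A := by
    intro Z
    induction Z using Finset.induction_on with
    | empty =>
      intro _
      refine ⟨{A | A.toLeft ∈ S ∧ A.toRight ∈ T}, fun A hA => ⟨hA.1, hA.2, by simp⟩, ?_, ?_⟩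
      · simpa using hS.disjSum hT
      · intro q _
        obtain ⟨J, hJ, K, hK, hle⟩ := hc q
        refine ⟨J.disjSum K, by simp [hJ, hK], ?_⟩
        simp only [netValue, sum_eq_toLeft_add_toRight, Finset.toLeft_disjSum,
          Finset.toRight_disjSum, Sum.elim_inl, Sum.elim_inr] at hle ⊢
        linarith
    | insert z Z hz ih =>
      intro hZY
      obtain ⟨R, hR, hsub, hbound⟩ := ih ((Finset.subset_insert _ _).trans hZY)
      have hab : (Sum.inl z : α ⊕ α) ≠ Sum.inr z := by simp
      have ha : Sum.inl z ∉ {x : α ⊕ α | Sum.elim id id x ∈ Z} := by simpa using hz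
      have hb : Sum.inr z ∉ {x : α ⊕ α | Sum.elim id id x ∈ Z} := by simpa using hz
      refine ⟨cutBy R (Sum.inl z) (Sum.inr z), ?_, ?_, ?_⟩
      · rintro A ⟨hA, hcut⟩
        refine ⟨(hR A hA).1, (hR A hA).2.1, ?_⟩
        intro y hy
        rcases Finset.mem_insert.1 hy with rfl | hy
        · simpa using hcut
        · exact (hR A hA).2.2 y hy
      · refine hsub.restrict_cutBy hab ha hb ?_ (by simp) (by simp)
        intro x hx
        exact Finset.mem_insert_of_mem hx
      · intro q hq
        have hzY : z ∈ Y := hZY (Finset.mem_insert_self _ _)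
        refine hsub.exists_mem_cutBy hab ha hb ?_ fun t => ?_
        · rintro (x | x) hx <;> exact hq x (Finset.mem_insert_of_mem hx)
        -- The multiplier `t` on both copies of `z` is a price change at `z`, allowed since z ∉ Z;
        -- as z ∈ Y, it adds `t` to the sum over `Y`.
        · obtain ⟨A, hA, hle⟩ := hbound (fun x => q x + if x = z then t else 0) (by
            intro x hx
            have hxz : x ≠ z := fun h => hz (h ▸ hx)
            simp [hxz, hq x (Finset.mem_insert_of_mem hx)])
          refine ⟨A, hA, ?_⟩
          have he : raise (Sum.elim q q) (Sum.inl z) (Sum.inr z) t t =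
              Sum.elim (fun x => q x + if x = z then t else 0)
                (fun x => q x + if x = z then t else 0) := by
            funext x
            rcases x with x | x <;> simp [raise]
          rw [he]
          simp only [Finset.sum_add_distrib, Finset.sum_ite_eq', hzY, if_true] at hle
          linarith
  obtain ⟨R, hR, -, hbound⟩ := key Y subset_rfl
  obtain ⟨A, hA, hle⟩ := hbound 0 (by simp)
  obtain ⟨hl, hr, hcut⟩ := hR A hA
  have hK : Y \ A.toLeft = A.toRight := by
    ext x
    have := @hTY _ hr x
    grind
  refine ⟨A.toLeft, hl, hK ▸ hr, ?_⟩
  rw [hK]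
  simpa [netValue, sum_eq_toLeft_add_toRight] using hle

end Intersection

/-! ### Multiple exchange for real values on a family -/

section MultipleExchange

variable {N : Type*} [DecidableEq N]

/-- Fixing the elements of `C` to be used and restricting the others to `Y`. -/
theorem ExchangeOn.contract {S : Set (Finset N)} {f : Finset N → ℝ} (h : ExchangeOn S f)
    {C Y : Finset N} (hCY : Disjoint C Y) :
    ExchangeOn {J | J ⊆ Y ∧ C ∪ J ∈ S} (fun J => f (C ∪ J)) := by
  rintro A ⟨hAY, hA⟩ B ⟨hBY, hB⟩ i hi
  have hY : ∀ x ∈ Y, x ∉ C := fun x hx hxC => Finset.disjoint_left.1 hCY hxC hx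
  have hiC : i ∉ C := hY i (hAY (Finset.mem_sdiff.1 hi).1)
  obtain ⟨X', hX', Y', hY', hle, hex⟩ := h _ hA _ hB i (by grind)
  have hX'C : C ∪ (X' \ C) = X' := by
    ext x
    grind
  have hY'C : C ∪ (Y' \ C) = Y' := by
    ext x
    grind
  refine ⟨X' \ C, ⟨?_, by rwa [hX'C]⟩, Y' \ C, ⟨?_, by rwa [hY'C]⟩, by simpa [hX'C, hY'C], ?_⟩
  · intro x
    grind
  · intro x
    grind
  · rcases hex with ⟨rfl, rfl⟩ | ⟨j, hj, rfl, rfl⟩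
    · left
      constructor <;> ext x <;> grind
    · right
      refine ⟨j, by grind, ?_, ?_⟩ <;> ext x <;> grind

theorem ExchangeOn.exists_multiple_exchange [Finite N] {S : Set (Finset N)} {f : Finset N → ℝ}
    (h : ExchangeOn S f) {X Y I : Finset N} (hX : X ∈ S) (hY : Y ∈ S) (hI : I ⊆ X \ Y) :
    ∃ J ⊆ Y \ X, (X \ I) ∪ J ∈ S ∧ (Y \ J) ∪ I ∈ S ∧
      f X + f Y ≤ f ((X \ I) ∪ J) + f ((Y \ J) ∪ I) := by
  have hd1 : Disjoint (X \ I) (Y \ X) := by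
    rw [Finset.disjoint_left]
    grind
  have hd2 : Disjoint ((X ∩ Y) ∪ I) (Y \ X) := by
    rw [Finset.disjoint_left]
    grind
  obtain ⟨J, ⟨hJY, hJS⟩, ⟨-, hKS⟩, hle⟩ := exists_partition_of_forall_price
    ((h.contract hd1).conjSubmodular ∅) ((h.contract hd2).conjSubmodular ∅) (Y \ X)
    (fun K hK => hK.1) (c := f X + f Y) (by
      intro q
      -- With price 0 off Y \ X, `X` pays nothing and `Y` pays all of q(Y \ X).
      obtain ⟨X', ⟨hX', hLX', hX'U⟩, Y', ⟨hY', hLY', hY'U⟩, hX'D, hY'D, hle⟩ :=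
        ((h.netValue fun x => if x ∈ Y \ X then q x else 0).interval (X ∩ Y)
          (X ∪ Y)).exists_distribute (X \ Y) (Y := Y)
          ⟨hY, Finset.inter_subset_right, Finset.subset_union_right⟩ (by ext x; grind) I X
          ⟨hX, Finset.inter_subset_left, Finset.subset_union_left⟩ (by intro x; grind)
      have hX'e : (X \ I) ∪ (X' ∩ (Y \ X)) = X' := by
        ext x
        have h1 := Finset.ext_iff.1 hX'D x
        have h2 := @hX'U x
        have h3 := @hLX' x
        have h4 := @hI x
        grind
      have hY'e : ((X ∩ Y) ∪ I) ∪ (Y' ∩ (Y \ X)) = Y' := by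
        ext x
        have h1 := Finset.ext_iff.1 hY'D x
        have h2 := @hY'U x
        have h3 := @hLY' x
        have h4 := @hI x
        grind
      refine ⟨X' ∩ (Y \ X), ⟨Finset.inter_subset_right, by rwa [hX'e]⟩,
        Y' ∩ (Y \ X), ⟨Finset.inter_subset_right, by rwa [hY'e]⟩, ?_⟩
      have hX0 : X ∩ (Y \ X) = ∅ := by
        ext x
        grind
      have hY0 : Y ∩ (Y \ X) = Y \ X := by
        ext x
        grind
      simp only [_root_.netValue, Finset.sum_ite_mem, hX0, hY0, Finset.sum_empty] at hle
      simp only [_root_.netValue, hX'e, hY'e]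
      linarith)
  have hK : ((X ∩ Y) ∪ I) ∪ ((Y \ X) \ J) = (Y \ J) ∪ I := by
    ext x
    have h1 := @hJY x
    grind
  rw [hK] at hKS hle
  exact ⟨J, hJY, hJS, hKS, hle⟩

end MultipleExchange

/-! ### Passage to values in ℝ ∪ {−∞} -/

theorem coe_unbotD_of_mem_effDom {N : Type*} {f : Finset N → WithBot ℝ} {X : Finset N}
    (hX : X ∈ effDom f) : ((WithBot.unbotD 0 (f X) : ℝ) : WithBot ℝ) = f X := by
  obtain ⟨a, ha⟩ := WithBot.ne_bot_iff_exists.1 (LT.lt.ne' (show ⊥ < f X from hX))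
  rw [← ha, WithBot.unbotD_coe]

/-- The default 0 is harmless: only values on the effective domain are compared. -/
theorem IsMNatConcave.exchangeOn {N : Type*} [DecidableEq N] {f : Finset N → WithBot ℝ}
    (hf : IsMNatConcave f) : ExchangeOn (effDom f) fun X => WithBot.unbotD 0 (f X) := by
  have real : ∀ {X Y X' Y' : Finset N}, X ∈ effDom f → Y ∈ effDom f → X' ∈ effDom f →
      Y' ∈ effDom f → f X + f Y ≤ f X' + f Y' →
      WithBot.unbotD 0 (f X) + WithBot.unbotD 0 (f Y) ≤
        WithBot.unbotD 0 (f X') + WithBot.unbotD 0 (f Y') := by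
    intro X Y X' Y' hX hY hX' hY' hle
    rw [← coe_unbotD_of_mem_effDom hX, ← coe_unbotD_of_mem_effDom hY,
      ← coe_unbotD_of_mem_effDom hX', ← coe_unbotD_of_mem_effDom hY'] at hle
    exact_mod_cast hle
  intro X hX Y hY i hi
  rcases hf.2 X hX Y hY i hi with ⟨hX', hY', hle⟩ | ⟨j, hj, hX', hY', hle⟩
  · exact ⟨_, hX', _, hY', real hX hY hX' hY' hle, Or.inl ⟨rfl, rfl⟩⟩
  · exact ⟨_, hX', _, hY', real hX hY hX' hY' hle, Or.inr ⟨j, hj, rfl, rfl⟩⟩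

theorem theorem1 {N : Type*} [Fintype N] [DecidableEq N] (f : Finset N → WithBot ℝ)
    (hf : IsMNatConcave f) : HasMultipleExchange f := by
  intro X Y I hI
  by_cases hX : X ∈ effDom f
  · by_cases hY : Y ∈ effDom f
    · obtain ⟨J, hJ, hX', hY', hle⟩ := hf.exchangeOn.exists_multiple_exchange hX hY hI
      refine ⟨J, hJ, ?_⟩
      rw [← coe_unbotD_of_mem_effDom hX, ← coe_unbotD_of_mem_effDom hY,
        ← coe_unbotD_of_mem_effDom hX', ← coe_unbotD_of_mem_effDom hY']
      exact_mod_cast hle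
    · have : f Y = ⊥ := not_bot_lt_iff.1 hY
      exact ⟨∅, by simp, by simp [this]⟩
  · have : f X = ⊥ := not_bot_lt_iff.1 hX
    exact ⟨∅, by simp, by simp [this]⟩
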